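/- Let $W$ be a finite Coxeter group with simple reflections $(s_i)_{i\in I}$ and Coxeter matrix $(m(i,j))$, and let $(a_{i,j})_{i,j\in I}$ be a real (generalized) Cartan matrix for $W$: $a_{i,i}=2$, $a_{i,j}\le 0$ for $i\neq j$, $a_{i,j}=0\Leftrightarrow a_{j,i}=0$, and $a_{i,j}a_{j,i}=4\cos^2(\pi/m(i,j))$ for $i\ne j$. Let $W$ act on $\bigoplus_{i\in I}\mathbb{R}\alpha_i$ by $s_i(x)=x-\langle\alpha_i^\vee,x\rangle\alpha_i$, where $\langle\alpha_i^\vee,\alpha_j\rangle=a_{i,j}$; the roots are the vectors $w(\alpha_i)$, and for a root $\alpha=w(\alpha_i)$ put $s_\alpha=ws_iw^{-1}$. For a root $\alpha$ define a right action on $W$ by $w.\pi_\alpha=ws_\alpha$ if the root $w(\alpha)$ is positive, and $w.\pi_\alpha=w$ otherwise. Extend it linearly to $\mathbb{C}W$, set $\pi_i=\pi_{\alpha_i}$ (so $w.\pi_i=w$ if $i$ is a right descent of $w$, and $w.\pi_i=ws_i$ otherwise), and $\pi_t=\pi_{i_1}\cdots\pi_{i_r}$ for any reduced word $i_1,\dots,i_r$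 of $t\in W$. All operators act on the right, so in a product the leftmost factor is applied first. The Hecke group algebra of $W$ is the subalgebra of $\operatorname{End}(\mathbb{C}W)$ generated by the right multiplications by the $s_i$ and by the $\pi_i$, $i\in I$. Let $\mathcal S$ be a set of roots such that the projections $\{\pi_\alpha \mid \alpha\in\mathcal S\}$ act transitively on $W$, i.e. for all $u,v\in W$ there are $\beta_1,\dots,\beta_r\in\mathcal S$ with $u.\pi_{\beta_1}\cdots\pi_{\beta_r}=v$. For $J\subseteq I$ let $W_J=\langle s_i\mid i\in J\rangle$. For every coset $wW_J$ choose an $\mathcal S$-reduced word: a word $\beta_1,\dots,\beta_r$ in $\mathcal S$ of minimal length such that $\nu.\pi_{\beta_1}\cdots\pi_{\beta_r}=\mu$ for some $\nu\in W_Jw^{-1}$ and $\mu\in W_J$. Put $\nabla_\beta=\pi_\beta-1$ and $\nabla_{wW_J}=\nabla_{\beta_1}\cdots\nabla_{\beta_r}$ for the chosen word. Let $D_L(w)=\{i\in I\mid \ell(s_iw)<\ell(w)\}$ and $D_R(w)=\{i\in I\mid \ell(ws_i)<\ell(w)\}$. Then, whatever the choice of the $\mathcal S$-reduced words, the family $$B=\{\nabla_{wW_{D_L(t)}}\,\pi_t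 \mid w,t\in W,\ D_R(w)\cap D_L(t)=\emptyset\},$$ indexed by the pairs $(w,t)$, is a basis of the Hecke group algebra of $W$ as a vector space over $\mathbb{C}$. -/

import Mathlib

open Module

noncomputable section

namespace HeckeGroup

variable {B W : Type*} [Group W] {M : CoxeterMatrix B}

/-! ### Cartan matrices, the geometric representation, roots -/

/-- `A` is a (generalized, real) Cartan matrix for the Coxeter matrix `M`
(Mathlib writes `M i j = 0` for an infinite label). -/
structure IsCartanMatrix (M : CoxeterMatrix B) (A : Matrix B B ℝ) : Prop where
  diag : ∀ i, A i i = 2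
  nonpos : ∀ i j, i ≠ j → A i j ≤ 0
  zero_symm : ∀ i j, A i j = 0 → A j i = 0
  mul_eq : ∀ i j, i ≠ j → M i j ≠ 0 →
    A i j * A j i = 4 * Real.cos (Real.pi / (M i j : ℝ)) ^ 2
  four_le : ∀ i j, i ≠ j → M i j = 0 → 4 ≤ A i j * A j i

/-- The root space `⨁ ℝ αᵢ`. -/
abbrev RootSpace (B : Type*) : Type _ := B →₀ ℝ

/-- The simple root `αᵢ`. -/
def simpleRoot (i : B) : RootSpace B := Finsupp.single i 1

/-- The simple coroot `αᵢ^∨`, the linear form with `⟨αᵢ^∨, αⱼ⟩ = A i j`. -/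
def simpleCoroot (A : Matrix B B ℝ) (i : B) : Dual ℝ (RootSpace B) :=
  Finsupp.linearCombination ℝ (A i)

theorem simpleCoroot_simpleRoot (A : Matrix B B ℝ) (i j : B) :
    simpleCoroot A i (simpleRoot j) = A i j := by
  simp [simpleCoroot, simpleRoot]

theorem IsCartanMatrix.coroot_self {A : Matrix B B ℝ} (hA : IsCartanMatrix M A) (i : B) :
    simpleCoroot A i (simpleRoot i) = 2 := by
  rw [simpleCoroot_simpleRoot, hA.diag]

/-- The simple reflection `x ↦ x - ⟨αᵢ^∨, x⟩ αᵢ` of the root space. -/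
def simpleReflection {A : Matrix B B ℝ} (hA : IsCartanMatrix M A) (i : B) :
    RootSpace B ≃ₗ[ℝ] RootSpace B :=
  Module.reflection (hA.coroot_self i)

theorem simpleReflection_apply {A : Matrix B B ℝ} (hA : IsCartanMatrix M A) (i : B)
    (x : RootSpace B) :
    simpleReflection hA i x = x - simpleCoroot A i x • simpleRoot i :=
  Module.reflection_apply x (hA.coroot_self i)

theorem simpleReflection_isLiftable {A : Matrix B B ℝ} (hA : IsCartanMatrix M A) :
    M.IsLiftable (simpleReflection hA) := by
  intro i j
  by_cases hij : i = j
  · subst hij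
    rw [M.diagonal, pow_one]
    ext1 x
    exact Module.involutive_reflection (hA.coroot_self i) x
  by_cases h0 : M i j = 0
  · rw [h0, pow_zero]
  have h1 : M i j ≠ 1 := M.off_diagonal i j hij
  have hprod := hA.mul_eq i j hij h0
  by_cases h2 : M i j = 2
  · have hz : A i j = 0 := by
      rw [h2] at hprod
      have hz' : A i j * A j i = 0 := by simp [hprod]
      rcases mul_eq_zero.mp hz' with h | h
      · exact h
      · exact hA.zero_symm _ _ h
    have hz2 := hA.zero_symm _ _ hz
    rw [h2, pow_two]
    ext1 x
    simp only [LinearEquiv.mul_apply, simpleReflection_apply, map_sub, map_smul,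
      simpleCoroot_simpleRoot, hz, hz2, hA.diag,
      LinearEquiv.coe_one, id_eq]
    module
  · have hm : 3 ≤ M i j := by omega
    generalize hmm : M i j = m at *
    have hm0 : (m : ℝ) ≠ 0 := by exact_mod_cast h0
    have hm3 : (3 : ℝ) ≤ m := by exact_mod_cast hm
    obtain ⟨φ, hφ⟩ : ∃ φ : ℝ, φ = 2 * (Real.pi / m) := ⟨_, rfl⟩
    have hmφ : (m : ℝ) * φ = 2 * Real.pi := by rw [hφ]; field_simp
    have ht : 2 * Real.cos φ
        = simpleCoroot A i (simpleRoot j) * simpleCoroot A j (simpleRoot i) - 2 := by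
      rw [simpleCoroot_simpleRoot, simpleCoroot_simpleRoot, hprod, hφ, Real.cos_two_mul]
      ring
    have hsin : Real.sin φ ≠ 0 := by
      apply ne_of_gt
      apply Real.sin_pos_of_pos_of_lt_pi
      · rw [hφ]; positivity
      · nlinarith [Real.pi_pos]
    have key := fun n : ℤ => Polynomial.Chebyshev.S_two_mul_real_cos φ n
    ext1 x
    change (((Module.reflection (hA.coroot_self i) *
      Module.reflection (hA.coroot_self j)) ^ m) x) = x
    rw [Module.reflection_mul_reflection_pow_apply (hA.coroot_self i) (hA.coroot_self j) m x
      (2 * Real.cos φ) ht]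
    rcases Nat.even_or_odd' m with ⟨k, hk | hk⟩
    · have e1 : ((m : ℤ) - 2) / 2 = k - 1 := by omega
      have e2 : ((m : ℤ) - 1) / 2 = k - 1 := by omega
      have hS : (Polynomial.Chebyshev.S ℝ ((k : ℤ) - 1)).eval (2 * Real.cos φ) = 0 := by
        have h := key ((k : ℤ) - 1)
        have hkφ : ((((k : ℤ) - 1 : ℤ) : ℝ) + 1) * φ = Real.pi := by
          rw [hk] at hmφ
          push_cast at hmφ ⊢
          linarith
        rw [hkφ, Real.sin_pi] at h
        exact (mul_eq_zero.mp h).resolve_right hsin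
      rw [e1, e2, hS]
      simp
    · have e1 : ((m : ℤ) - 3) / 2 = k - 1 := by omega
      have e2 : ((m : ℤ) - 1) / 2 = k := by omega
      have e3 : (m : ℤ) / 2 = k := by omega
      have e4 : ((m : ℤ) - 2) / 2 = k - 1 := by omega
      have hS : (Polynomial.Chebyshev.S ℝ (k : ℤ)).eval (2 * Real.cos φ)
          + (Polynomial.Chebyshev.S ℝ ((k : ℤ) - 1)).eval (2 * Real.cos φ) = 0 := by
        have h := key (k : ℤ)
        have h' := key ((k : ℤ) - 1)
        have hs : Real.sin ((((k : ℤ) : ℝ) + 1) * φ)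
            = - Real.sin (((((k : ℤ) - 1 : ℤ) : ℝ) + 1) * φ) := by
          have : (((k : ℤ) : ℝ) + 1) * φ
              = 2 * Real.pi - ((((k : ℤ) - 1 : ℤ) : ℝ) + 1) * φ := by
            rw [hk] at hmφ
            push_cast at hmφ ⊢
            linarith
          rw [this, Real.sin_two_pi_sub]
        refine (mul_eq_zero.mp (?_ : _ * Real.sin φ = 0)).resolve_right hsin
        rw [add_mul, h, h', hs]
        ring
      rw [e1, e2, e3, e4, hS]
      simp

/-- The geometric representation of `W` on the root space, `sᵢ ↦ (x ↦ x - ⟨αᵢ^∨, x⟩ αᵢ)`. -/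
def geomRep (cs : CoxeterSystem M W) {A : Matrix B B ℝ} (hA : IsCartanMatrix M A) :
    W →* (RootSpace B ≃ₗ[ℝ] RootSpace B) :=
  cs.lift ⟨simpleReflection hA, simpleReflection_isLiftable hA⟩

theorem geomRep_simple (cs : CoxeterSystem M W) {A : Matrix B B ℝ} (hA : IsCartanMatrix M A)
    (i : B) : geomRep cs hA (cs.simple i) = simpleReflection hA i :=
  cs.lift_apply_simple (simpleReflection_isLiftable hA) i

/-- The type of roots, `{w(αᵢ) | w ∈ W, i ∈ I}`. -/
def Root (cs : CoxeterSystem M W) {A : Matrix B B ℝ} (hA : IsCartanMatrix M A) : Type _ :=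
  {α : RootSpace B // ∃ (w : W) (i : B), geomRep cs hA w (simpleRoot i) = α}

/-- The reflection `s_α = w sᵢ w⁻¹ ∈ W` of a root `α = w(αᵢ)`. -/
def rootReflection (cs : CoxeterSystem M W) {A : Matrix B B ℝ} (hA : IsCartanMatrix M A)
    (α : Root cs hA) : W :=
  α.2.choose * cs.simple α.2.choose_spec.choose * (α.2.choose)⁻¹

/-- The open fundamental chamber `C = {x^∨ | ⟨x^∨, αᵢ⟩ > 0 for all i}` in the dual space. -/
def fundamentalChamber (B : Type*) : Set (Dual ℝ (RootSpace B)) :=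
  {x | ∀ i, 0 < x (simpleRoot i)}

/-- `C` lies in the positive open half space of `α`; a root with this property is positive. -/
def IsPositive (α : RootSpace B) : Prop :=
  ∀ x ∈ fundamentalChamber B, 0 < x α

open Classical in
/-- The right action `w ↦ w.π_α` on `W` of the projection attached to a root `α`:
`w.π_α = w s_α` if `⟨w⁻¹(x^∨), α⟩ = ⟨x^∨, w(α)⟩ > 0` for `x^∨` in the fundamental chamber
(that is, if the root `w(α)` is positive), and `w.π_α = w` otherwise. -/
def rootProj (cs : CoxeterSystem M W) {A : Matrix B B ℝ} (hA : IsCartanMatrix M A)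
    (α : Root cs hA) (w : W) : W :=
  if IsPositive (geomRep cs hA w α.1) then w * rootReflection cs hA α else w

/-- `w.π_{α₁}⋯π_{αᵣ}` (the first letter of the word acts first). -/
def rootProjWord (cs : CoxeterSystem M W) {A : Matrix B B ℝ} (hA : IsCartanMatrix M A)
    {S : Set (Root cs hA)} (w : W) (l : List S) : W :=
  l.foldl (fun v α => rootProj cs hA α.1 v) w

/-- The projections `π_α`, `α ∈ S`, act transitively on `W`: every element can be carried to
every other one by a product of them. -/
def ActsTransitively (cs : CoxeterSystem M W) {A : Matrix B B ℝ} (hA : IsCartanMatrix M A)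
    (S : Set (Root cs hA)) : Prop :=
  ∀ u v : W, ∃ l : List S, rootProjWord cs hA u l = v

/-! ### Cosets and `S`-reduced words -/

/-- The parabolic subgroup `W_J`. -/
def parabolic (cs : CoxeterSystem M W) (J : Set B) : Subgroup W :=
  Subgroup.closure (cs.simple '' J)

/-- The word `l` sorts the coset `c = w W_J`: there are `ν ∈ W_J w⁻¹` (i.e. `ν⁻¹ ∈ w W_J`)
and `μ ∈ W_J` with `ν.π_{α₁}⋯π_{αᵣ} = μ`. -/
def SortsCoset (cs : CoxeterSystem M W) {A : Matrix B B ℝ} (hA : IsCartanMatrix M A)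
    {S : Set (Root cs hA)} (J : Set B) (c : W ⧸ parabolic cs J) (l : List S) : Prop :=
  ∃ ν μ : W, ((ν⁻¹ : W) : W ⧸ parabolic cs J) = c ∧ μ ∈ parabolic cs J ∧
    rootProjWord cs hA ν l = μ

/-- `l` is an `S`-reduced word for the coset `c`: a word of minimal length that sorts `c`. -/
def IsReducedWordFor (cs : CoxeterSystem M W) {A : Matrix B B ℝ} (hA : IsCartanMatrix M A)
    {S : Set (Root cs hA)} (J : Set B) (c : W ⧸ parabolic cs J) (l : List S) : Prop :=
  SortsCoset cs hA J c l ∧ ∀ l' : List S, SortsCoset cs hA J c l' → l.length ≤ l'.length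

/-! ### Operators on `ℂW`, acting on the right -/

/-- The algebra of endomorphisms of the vector space `ℂW` acting on the right: in a product
`f * g`, the operator `f` is applied first. -/
abbrev RightEnd (W : Type*) : Type _ := (Module.End ℂ (W →₀ ℂ))ᵐᵒᵖ

/-- The operator on `ℂW` extending linearly a map `W → W`. -/
def opOf (f : W → W) : RightEnd W := MulOpposite.op (Finsupp.lmapDomain ℂ ℂ f)

/-- The operator of right multiplication by `w ∈ W`. -/
def rightMul (w : W) : RightEnd W := opOf (fun v => v * w)

open Classical in
/-- The operator `πᵢ` of the right regular representation of the `0`-Hecke algebra: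
`w.πᵢ = w` if `i` is a right descent of `w`, and `w.πᵢ = w sᵢ` otherwise. -/
def simplePi (cs : CoxeterSystem M W) (i : B) : RightEnd W :=
  opOf (fun w => if cs.IsRightDescent w i then w else w * cs.simple i)

/-- `π_t = π_{i₁}⋯π_{iᵣ}` for a reduced word `i₁,…,iᵣ` of `t`
(by the braid relations it does not depend on the reduced word). -/
def piElt (cs : CoxeterSystem M W) (t : W) : RightEnd W :=
  ((cs.exists_isReduced t).choose.map (simplePi cs)).prod

/-- The Hecke group algebra of `W`: the subalgebra of the endomorphisms of `ℂW` generated by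
the operators `sᵢ` (right multiplications) and `πᵢ`. -/
def heckeGroupAlgebra (cs : CoxeterSystem M W) : Subalgebra ℂ (RightEnd W) :=
  Algebra.adjoin ℂ (Set.range (fun i => rightMul (cs.simple i)) ∪ Set.range (simplePi cs))

/-- `∇_α = π_α - 1`. -/
def nabla (cs : CoxeterSystem M W) {A : Matrix B B ℝ} (hA : IsCartanMatrix M A)
    (α : Root cs hA) : RightEnd W :=
  opOf (rootProj cs hA α) - 1

/-- `∇_{α₁}⋯∇_{αᵣ}`. -/
def nablaWord (cs : CoxeterSystem M W) {A : Matrix B B ℝ} (hA : IsCartanMatrix M A)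
    {S : Set (Root cs hA)} (l : List S) : RightEnd W :=
  (l.map (fun α => nabla cs hA α.1)).prod

/-- The left descent set. -/
def leftDescents (cs : CoxeterSystem M W) (w : W) : Set B := {i | cs.IsLeftDescent w i}

/-- The right descent set. -/
def rightDescents (cs : CoxeterSystem M W) (w : W) : Set B := {i | cs.IsRightDescent w i}

/-- The index set of the family: pairs `(w, t)` with `D_R(w) ∩ D_L(t) = ∅`. -/
abbrev BasisIndex (cs : CoxeterSystem M W) : Type _ :=
  {p : W × W // rightDescents cs p.1 ∩ leftDescents cs p.2 = ∅}

end HeckeGroup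

end

open Module

noncomputable section

namespace HeckeGroup

variable {B W : Type*} [Group W] {M : CoxeterMatrix B}

/-! ### Positivity of roots -/

/-! Two bounds on the dimension of the algebra meet at the number of pairs (w, t). Write J = D_L(t).

Upper bound: the generators preserve each space {v | sᵢ v = -v} (`preservesAntisymmetry_of_mem`).
Since t is the longest element of W_J t, the alternating sums over the sets W_J t are unitriangular
in t, so an operator is determined by its values on them. Such a value is again antisymmetric under
J, hence fixed by its coefficients at the minimal elements of the cosets W_J x, which are the w⁻¹
with D_R(w) ∩ J = ∅. The algebra thus embeds in a space with one coordinate per pair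
(`injective_antisymmetryCoeff_comp_subtype`).

Lower bound: x.π_t equals t for x ∈ W_J and is longer than t otherwise (`length_demazureElt`), so
coefficients at t are triangular in ℓ(t), and for fixed t they sum a vector over W_J. Expanding a
product of operators ∇_β = π_β - 1 at ν gives signed subwords. If no shorter word carries ν into
W_J, only the full word can; each of its letters then acts by its reflection, and the product of
these reflections determines the coset. So for fixed t there is triangularity in the word length
(`IsReducedWordFor.parabolicCoeff_eq_zero`), and independence follows (`eq_zero_of_sum_nablaPi`).

The Coxeter combinatorics behind both bounds (exchange, lengths in cosets, the Demazure product)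
rests on the signs of the coordinates of w(αᵢ) (`geomRep_simpleRoot_nonneg`). -/

/-- The sequence `u₀ = 0`, `u₁ = 1`, `uₖ₊₂ = τ uₖ₊₁ - uₖ`. -/
def dihedralSeq (τ : ℝ) : ℕ → ℝ
  | 0 => 0
  | 1 => 1
  | k + 2 => τ * dihedralSeq τ (k + 1) - dihedralSeq τ k

theorem dihedralSeq_add_two (τ : ℝ) (k : ℕ) :
    dihedralSeq τ (k + 2) = τ * dihedralSeq τ (k + 1) - dihedralSeq τ k := rfl

theorem dihedralSeq_nonneg_of_two_le {τ : ℝ} (hτ : 2 ≤ τ) (k : ℕ) :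
    0 ≤ dihedralSeq τ k ∧ dihedralSeq τ k ≤ dihedralSeq τ (k + 1) := by
  induction k with
  | zero => simp [dihedralSeq]
  | succ k ih =>
    refine ⟨ih.1.trans ih.2, ?_⟩
    rw [dihedralSeq_add_two]
    nlinarith [ih.1, ih.2]

theorem sin_mul_dihedralSeq (θ : ℝ) (k : ℕ) :
    Real.sin θ * dihedralSeq (2 * Real.cos θ) k = Real.sin (k * θ) ∧
      Real.sin θ * dihedralSeq (2 * Real.cos θ) (k + 1) = Real.sin ((k + 1) * θ) := by
  induction k with
  | zero => simp [dihedralSeq]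
  | succ k ih =>
    refine ⟨by push_cast; exact ih.2, ?_⟩
    have h1 := ih.1
    have h2 := ih.2
    have e1 : (k : ℝ) * θ = (k + 1) * θ - θ := by ring
    have e2 : ((k + 1 : ℕ) + 1 : ℝ) * θ = (k + 1) * θ + θ := by push_cast; ring
    rw [e1, Real.sin_sub] at h1
    rw [dihedralSeq_add_two, e2, Real.sin_add]
    linear_combination (2 * Real.cos θ) * h2 - h1

theorem dihedralSeq_two_mul_cos_nonneg {m k : ℕ} (hm : 2 ≤ m) (hk : k ≤ m) :
    0 ≤ dihedralSeq (2 * Real.cos (Real.pi / m)) k := by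
  have hm' : (2 : ℝ) ≤ m := by exact_mod_cast hm
  have hk' : (k : ℝ) ≤ m := by exact_mod_cast hk
  have hpos : 0 < Real.sin (Real.pi / m) := by
    apply Real.sin_pos_of_pos_of_lt_pi (by positivity)
    rw [div_lt_iff₀ (by linarith)]
    nlinarith [Real.pi_pos]
  refine nonneg_of_mul_nonneg_right ?_ hpos
  rw [(sin_mul_dihedralSeq _ k).1]
  apply Real.sin_nonneg_of_nonneg_of_le_pi (by positivity)
  rw [mul_div_assoc', div_le_iff₀ (by linarith)]
  nlinarith [Real.pi_pos]

/-- The simple roots `αᵢ`, `αⱼ` can be rescaled so as to make the Cartan matrix symmetric. -/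
theorem IsCartanMatrix.exists_symmetrization {A : Matrix B B ℝ} (hA : IsCartanMatrix M A)
    {i j : B} (hij : i ≠ j) :
    ∃ r τ : ℝ, 0 < r ∧ A j i = -(r * τ) ∧ A i j * r = -τ ∧
      ∀ k : ℕ, (M i j ≠ 0 → k ≤ M i j) → 0 ≤ dihedralSeq τ k := by
  have hp := hA.nonpos i j hij
  have hq := hA.nonpos j i hij.symm
  -- Here τ = √(A i j * A j i): it is 2cos(π/m) for a finite label m and at least 2 for an infinite
  -- one. The two equations force r = τ / (-A i j), unless both entries vanish.
  obtain ⟨r, hr, h1, h2⟩ : ∃ r : ℝ, 0 < r ∧ A j i = -(r * √(A i j * A j i)) ∧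
      A i j * r = -√(A i j * A j i) := by
    by_cases h0 : A i j = 0
    · exact ⟨1, one_pos, by simp [h0, hA.zero_symm _ _ h0], by simp [h0]⟩
    · have h0' : A j i ≠ 0 := fun h => h0 (hA.zero_symm _ _ h)
      have hp' : A i j < 0 := lt_of_le_of_ne hp h0
      have hq' : A j i < 0 := lt_of_le_of_ne hq h0'
      have hpq : 0 < A i j * A j i := mul_pos_of_neg_of_neg hp' hq'
      refine ⟨√(A i j * A j i) / (-A i j), div_pos (Real.sqrt_pos.2 hpq) (by linarith), ?_, ?_⟩
      · rw [div_mul_eq_mul_div, Real.mul_self_sqrt hpq.le]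
        field_simp
      · field_simp
  refine ⟨r, _, hr, h1, h2, fun k hk => ?_⟩
  by_cases hm : M i j = 0
  · refine (dihedralSeq_nonneg_of_two_le ?_ k).1
    have := hA.four_le i j hij hm
    exact Real.le_sqrt_of_sq_le (by linarith)
  · have hm2 : 2 ≤ M i j := by
      have := M.off_diagonal i j hij
      omega
    have hm' : (2 : ℝ) ≤ M i j := by exact_mod_cast hm2
    have hcos : 0 ≤ Real.cos (Real.pi / M i j) := by
      apply Real.cos_nonneg_of_neg_pi_div_two_le_of_le
      · have : 0 ≤ Real.pi / M i j := by positivity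
        linarith [Real.pi_pos]
      · gcongr
    rw [hA.mul_eq i j hij hm, show 4 * Real.cos (Real.pi / M i j) ^ 2 =
      (2 * Real.cos (Real.pi / M i j)) ^ 2 by ring, Real.sqrt_sq (by positivity)]
    exact dihedralSeq_two_mul_cos_nonneg hm2 (hk hm)

variable (cs : CoxeterSystem M W) {A : Matrix B B ℝ} (hA : IsCartanMatrix M A)

theorem geomRep_mul_apply (v w : W) (x : RootSpace B) :
    geomRep cs hA (v * w) x = geomRep cs hA v (geomRep cs hA w x) := by
  rw [map_mul]; rfl

theorem geomRep_one_apply (x : RootSpace B) : geomRep cs hA 1 x = x := by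
  rw [map_one]; rfl

theorem geomRep_inv_apply_self (w : W) (x : RootSpace B) :
    geomRep cs hA w⁻¹ (geomRep cs hA w x) = x := by
  rw [← geomRep_mul_apply, inv_mul_cancel, geomRep_one_apply]

theorem geomRep_simple_apply (i : B) (x : RootSpace B) :
    geomRep cs hA (cs.simple i) x = x - simpleCoroot A i x • simpleRoot i := by
  rw [geomRep_simple, simpleReflection_apply]

theorem geomRep_simple_simpleRoot_self (i : B) :
    geomRep cs hA (cs.simple i) (simpleRoot i) = -simpleRoot i := by
  rw [geomRep_simple_apply, hA.coroot_self, two_smul]; abel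

theorem simpleRoot_nonneg (i : B) : (0 : RootSpace B) ≤ simpleRoot i := by
  classical
  intro k
  simp only [simpleRoot, Finsupp.single_apply, Finsupp.coe_zero, Pi.zero_apply]
  split_ifs <;> norm_num

/-- In the basis αᵢ, r αⱼ both off-diagonal Cartan entries are -τ. Each new reflection changes one
coordinate, to τ times the other minus itself, which is the recurrence of `dihedralSeq`. -/
theorem geomRep_alternatingWord {i j : B} {r τ : ℝ} (h1 : A j i = -(r * τ)) (h2 : A i j * r = -τ)
    (k : ℕ) :
    geomRep cs hA (cs.wordProd (CoxeterSystem.alternatingWord i j k)) (simpleRoot i) =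
      if Even k then
        dihedralSeq τ (k + 1) • simpleRoot i + (r * dihedralSeq τ k) • simpleRoot j
      else dihedralSeq τ k • simpleRoot i + (r * dihedralSeq τ (k + 1)) • simpleRoot j := by
  induction k with
  | zero => simp [CoxeterSystem.alternatingWord, dihedralSeq]
  | succ k ih =>
    rw [CoxeterSystem.alternatingWord_succ', cs.wordProd_cons, geomRep_mul_apply, ih,
      dihedralSeq_add_two]
    by_cases hk : Even k
    · have hk' : ¬ Even (k + 1) := by simpa [Nat.even_add_one] using hk
      simp only [if_pos hk, if_neg hk', geomRep_simple_apply, map_add, map_smul,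
        simpleCoroot_simpleRoot, hA.diag, h1]
      module
    · have hk' : Even (k + 1) := by simpa [Nat.even_add_one] using hk
      simp only [if_neg hk, if_pos hk', geomRep_simple_apply, map_add, map_smul,
        simpleCoroot_simpleRoot, hA.diag]
      generalize dihedralSeq τ k = a, dihedralSeq τ (k + 1) = b
      obtain rfl : τ = -(A i j * r) := by linarith
      module

/-- At k = M i j the braid relation rewrites the alternating word so that it ends in i, and the last
letter cancels. For larger k the first letter is absorbed into v. -/
theorem length_mul_alternatingWord_lt {i j : B} (v : W) {k : ℕ} (hm : M i j ≠ 0)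
    (hk : M i j ≤ k) :
    cs.length (v * cs.wordProd (CoxeterSystem.alternatingWord i j k) * cs.simple i) <
      cs.length v + k := by
  induction k, hk using Nat.le_induction generalizing v with
  | base =>
    have hb := cs.wordProd_braidWord_eq i j
    unfold CoxeterSystem.braidWord at hb
    rw [hb, M.symmetric j i]
    obtain ⟨n, hn⟩ : ∃ n, M i j = n + 1 := ⟨M i j - 1, by omega⟩
    rw [hn, CoxeterSystem.alternatingWord_succ, cs.wordProd_concat, ← mul_assoc,
      cs.simple_mul_simple_cancel_right]
    have h3 := cs.length_mul_le v (cs.wordProd (CoxeterSystem.alternatingWord i j n))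
    have h4 := cs.length_wordProd_le (CoxeterSystem.alternatingWord i j n)
    rw [CoxeterSystem.length_alternatingWord] at h4
    omega
  | succ k _ ih =>
    rw [CoxeterSystem.alternatingWord_succ', cs.wordProd_cons, ← mul_assoc v]
    have h3 := cs.length_mul_le v (cs.simple (if Even k then j else i))
    rw [cs.length_simple] at h3
    have := ih (v * cs.simple (if Even k then j else i))
    omega

/-- If `w sᵢ` is longer than `w`, then the root `w(αᵢ)` is a nonnegative combination of the
simple roots. -/
theorem geomRep_simpleRoot_nonneg {w : W} {i : B} (h : ¬ cs.IsRightDescent w i) :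
    0 ≤ geomRep cs hA w (simpleRoot i) := by
  induction hn : cs.length w using Nat.strong_induction_on generalizing w i with
  | _ n ih =>
  subst hn
  by_cases hw : w = 1
  · subst hw
    rw [geomRep_one_apply]
    exact simpleRoot_nonneg i
  obtain ⟨j, hj⟩ := cs.exists_rightDescent_of_ne_one hw
  have hij : i ≠ j := fun e => h (e ▸ hj)
  -- Split off the longest alternating suffix in i, j with lengths adding. The remaining v has
  -- neither i nor j as a right descent: one letter would extend the suffix, the other would cancel
  -- its first letter and shorten w.
  let P : ℕ → Prop := fun k => ∃ v : W,
    v * cs.wordProd (CoxeterSystem.alternatingWord i j k) = w ∧ cs.length v + k = cs.length w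
  have hP1 : P 1 := ⟨w * cs.simple j, by simp [CoxeterSystem.alternatingWord],
    cs.isRightDescent_iff.1 hj⟩
  have hPle : ∀ k, P k → k ≤ cs.length w := by
    rintro k ⟨v, -, hv⟩
    omega
  classical
  obtain ⟨k, hk1, ⟨v, hvw, hlen⟩, hmax⟩ : ∃ k, 1 ≤ k ∧ P k ∧ ¬ P (k + 1) := by
    refine ⟨Nat.findGreatest P (cs.length w), ?_, ?_, ?_⟩
    · exact Nat.le_findGreatest (hPle 1 hP1) hP1
    · exact Nat.findGreatest_spec (hPle 1 hP1) hP1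
    · intro hc
      have := Nat.le_findGreatest (hPle _ hc) hc
      omega
  have hvi : ∀ l, l = i ∨ l = j → ¬ cs.IsRightDescent v l := by
    intro l hl hd
    have hd' := cs.isRightDescent_iff.1 hd
    by_cases hl' : l = if Even k then j else i
    · apply hmax
      refine ⟨v * cs.simple l, ?_, by omega⟩
      rw [CoxeterSystem.alternatingWord_succ', cs.wordProd_cons, ← hl', mul_assoc,
        cs.simple_mul_simple_cancel_left, hvw]
    · obtain ⟨k, rfl⟩ : ∃ k', k = k' + 1 := ⟨k - 1, by omega⟩
      have hl2 : l = if Even k then j else i := by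
        by_cases hk : Even k
        · simp [Nat.even_add_one, hk] at hl' ⊢; tauto
        · simp [Nat.even_add_one, hk] at hl' ⊢; tauto
      rw [CoxeterSystem.alternatingWord_succ', cs.wordProd_cons, ← hl2, ← mul_assoc] at hvw
      have h3 := cs.length_mul_le (v * cs.simple l)
        (cs.wordProd (CoxeterSystem.alternatingWord i j k))
      have h4 := cs.length_wordProd_le (CoxeterSystem.alternatingWord i j k)
      rw [CoxeterSystem.length_alternatingWord] at h4
      rw [hvw] at h3
      omega
  -- Otherwise w sᵢ would be shorter than w. The bound is needed at k + 1 because that term of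
  -- `dihedralSeq` also occurs as a coefficient.
  have hkm : M i j ≠ 0 → k + 1 ≤ M i j := by
    intro hm
    by_contra hc
    have := length_mul_alternatingWord_lt cs v hm (by omega : M i j ≤ k)
    rw [hvw, hlen] at this
    exact h this
  obtain ⟨r, τ, hr, h1, h2, hpos⟩ := hA.exists_symmetrization hij
  have hi0 := ih _ (by omega) (hvi i (Or.inl rfl)) rfl
  have hj0 := ih _ (by omega) (hvi j (Or.inr rfl)) rfl
  have p1 := hpos k fun hm => (Nat.le_succ k).trans (hkm hm)
  have p2 := hpos (k + 1) hkm
  rw [← hvw, geomRep_mul_apply, geomRep_alternatingWord cs hA h1 h2]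
  split_ifs <;> rw [map_add, map_smul, map_smul] <;>
    exact add_nonneg (smul_nonneg (by positivity) hi0) (smul_nonneg (by positivity) hj0)

theorem geomRep_mul_simple_simpleRoot (w : W) (i : B) :
    geomRep cs hA (w * cs.simple i) (simpleRoot i) = -geomRep cs hA w (simpleRoot i) := by
  rw [geomRep_mul_apply, geomRep_simple_simpleRoot_self, map_neg]

theorem geomRep_simpleRoot_nonpos {w : W} {i : B} (h : cs.IsRightDescent w i) :
    geomRep cs hA w (simpleRoot i) ≤ 0 := by
  have := geomRep_simpleRoot_nonneg cs hA (cs.isRightDescent_iff_not_isRightDescent_mul.1 h)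
  rw [geomRep_mul_simple_simpleRoot] at this
  exact neg_nonneg.1 this

theorem geomRep_simpleRoot_ne_zero (w : W) (i : B) : geomRep cs hA w (simpleRoot i) ≠ 0 := by
  rw [Ne, LinearEquiv.map_eq_zero_iff]
  simp [simpleRoot]

theorem isRightDescent_iff_geomRep_nonpos {w : W} {i : B} :
    cs.IsRightDescent w i ↔ geomRep cs hA w (simpleRoot i) ≤ 0 := by
  refine ⟨geomRep_simpleRoot_nonpos cs hA, fun h => ?_⟩
  by_contra hd
  exact geomRep_simpleRoot_ne_zero cs hA w i (le_antisymm h (geomRep_simpleRoot_nonneg cs hA hd))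

theorem not_isRightDescent_iff_geomRep_nonneg {w : W} {i : B} :
    ¬ cs.IsRightDescent w i ↔ 0 ≤ geomRep cs hA w (simpleRoot i) := by
  refine ⟨geomRep_simpleRoot_nonneg cs hA, fun h hd => ?_⟩
  exact geomRep_simpleRoot_ne_zero cs hA w i (le_antisymm (geomRep_simpleRoot_nonpos cs hA hd) h)

theorem linearMap_apply_eq_sum {V : Type*} [AddCommGroup V] [Module ℝ V]
    (f : RootSpace B →ₗ[ℝ] V) (x : RootSpace B) :
    f x = ∑ k ∈ x.support, x k • f (simpleRoot k) := by
  conv_lhs => rw [← Finsupp.sum_single x]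
  simp only [Finsupp.sum, map_sum]
  refine Finset.sum_congr rfl fun k _ => ?_
  rw [← map_smul, simpleRoot, Finsupp.smul_single_one]

theorem isPositive_of_nonneg {α : RootSpace B} (h : 0 ≤ α) (h0 : α ≠ 0) : IsPositive α := by
  intro x hx
  rw [linearMap_apply_eq_sum]
  refine Finset.sum_pos (fun k hk => ?_) (Finsupp.support_nonempty_iff.2 h0)
  exact mul_pos (lt_of_le_of_ne (h k) (Ne.symm (Finsupp.mem_support_iff.1 hk))) (hx k)

theorem not_isPositive_of_nonpos {α : RootSpace B} (h : α ≤ 0) : ¬ IsPositive α := by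
  intro hα
  have h1 := hα (Finsupp.linearCombination ℝ fun _ => 1) fun i => by simp [simpleRoot]
  rw [linearMap_apply_eq_sum] at h1
  refine h1.not_ge (Finset.sum_nonpos fun k _ => ?_)
  simpa [simpleRoot] using h k

theorem isPositive_geomRep_iff {w : W} {i : B} :
    IsPositive (geomRep cs hA w (simpleRoot i)) ↔ ¬ cs.IsRightDescent w i := by
  refine ⟨fun h hd => not_isPositive_of_nonpos (geomRep_simpleRoot_nonpos cs hA hd) h,
    fun h => isPositive_of_nonneg (geomRep_simpleRoot_nonneg cs hA h)
      (geomRep_simpleRoot_ne_zero cs hA w i)⟩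

/-- A nontrivial element has a right descent, so it sends some simple root to a nonpositive vector.
-/
theorem geomRep_injective : Function.Injective (geomRep cs hA) := by
  rw [injective_iff_map_eq_one]
  intro g hg
  by_contra h
  obtain ⟨i, hi⟩ := cs.exists_rightDescent_of_ne_one h
  have := geomRep_simpleRoot_nonpos cs hA hi
  rw [hg] at this
  have h1 := this i
  simp [simpleRoot] at h1
  exact absurd h1 (by norm_num)

/-! ### The exchange property -/

section
include hA

/-- Since sᵢ changes only the i-th coordinate, the sign change forces w(αⱼ) = c αᵢ. The Cartan
matrix need not be symmetric, so c is not known to be 1. Still, sᵢ w sⱼ w⁻¹ is a transvection along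
αᵢ; having finite order it acts trivially, and the representation is faithful. -/
theorem simple_mul_eq_mul_simple [Finite W] {w : W} {i j : B} (h : ¬ cs.IsRightDescent w j)
    (h' : cs.IsRightDescent (cs.simple i * w) j) :
    cs.simple i * w = w * cs.simple j := by
  have hpos := geomRep_simpleRoot_nonneg cs hA h
  have hneg := geomRep_simpleRoot_nonpos cs hA h'
  rw [geomRep_mul_apply, geomRep_simple_apply] at hneg
  obtain ⟨c, hc⟩ : ∃ c : ℝ, geomRep cs hA w (simpleRoot j) = c • simpleRoot i := by
    refine ⟨geomRep cs hA w (simpleRoot j) i, ?_⟩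
    ext k
    by_cases hk : i = k
    · subst hk; simp [simpleRoot]
    · have h1 := hneg k
      have h2 := hpos k
      simp only [simpleRoot, Finsupp.coe_sub, Finsupp.coe_smul, Pi.sub_apply, Pi.smul_apply,
        Finsupp.single_eq_of_ne' hk, smul_zero, sub_zero, Finsupp.coe_zero, Pi.zero_apply] at h1 h2 ⊢
      exact le_antisymm h1 h2
  have hc0 : c ≠ 0 := by
    rintro rfl
    exact geomRep_simpleRoot_ne_zero cs hA w j (by rw [hc, zero_smul])
  let ψ : RootSpace B → ℝ := fun x =>
    c * simpleCoroot A j (geomRep cs hA w⁻¹ x) - simpleCoroot A i x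
  have hg : ∀ x, geomRep cs hA (cs.simple i * w * cs.simple j * w⁻¹) x = x + ψ x • simpleRoot i := by
    intro x
    have hw : geomRep cs hA w (geomRep cs hA w⁻¹ x) = x := by
      rw [← geomRep_mul_apply, mul_inv_cancel, geomRep_one_apply]
    rw [mul_assoc, mul_assoc, geomRep_mul_apply, geomRep_mul_apply cs hA w,
      geomRep_mul_apply cs hA (cs.simple j), geomRep_simple_apply cs hA j, map_sub, map_smul, hw, hc,
      geomRep_simple_apply, map_sub, map_smul, map_smul, hA.coroot_self]
    simp only [ψ, smul_eq_mul]
    module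
  -- The form ψ kills αᵢ because w⁻¹(αᵢ) = c⁻¹ αⱼ, so powers of the element add up multiples of ψ.
  have hψ : ∀ (a : ℝ) x, ψ (x + a • simpleRoot i) = ψ x := by
    intro a x
    have : geomRep cs hA w⁻¹ (simpleRoot i) = c⁻¹ • simpleRoot j := by
      rw [eq_inv_smul_iff₀ hc0, ← map_smul, ← hc, geomRep_inv_apply_self]
    simp only [ψ, map_add, map_smul, this, hA.coroot_self, smul_eq_mul]
    field_simp
    ring
  have hpow : ∀ (n : ℕ) x, geomRep cs hA ((cs.simple i * w * cs.simple j * w⁻¹) ^ n) x =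
      x + (n * ψ x) • simpleRoot i := by
    intro n x
    induction n with
    | zero => simp
    | succ n ih =>
      rw [pow_succ', geomRep_mul_apply, ih, hg, hψ]
      push_cast
      module
  have hone : cs.simple i * w * cs.simple j * w⁻¹ = 1 := by
    apply geomRep_injective cs hA
    ext1 x
    rw [hg, geomRep_one_apply]
    have h1 := hpow (orderOf (cs.simple i * w * cs.simple j * w⁻¹)) x
    rw [pow_orderOf_eq_one, geomRep_one_apply, left_eq_add, smul_eq_zero] at h1
    have h2 : simpleRoot i ≠ (0 : RootSpace B) := by simp [simpleRoot]
    have h3 := (orderOf_pos (cs.simple i * w * cs.simple j * w⁻¹)).ne'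
    have h4 := (mul_eq_zero.1 (h1.resolve_right h2)).resolve_left (by exact_mod_cast h3)
    rw [h4, zero_smul, add_zero]
  rw [mul_inv_eq_one] at hone
  conv_rhs => rw [← hone]
  rw [cs.simple_mul_simple_cancel_right]

theorem simple_mul_eq_mul_simple' [Finite W] {w : W} {i j : B} (h : cs.IsRightDescent w j)
    (h' : ¬ cs.IsRightDescent (cs.simple i * w) j) :
    cs.simple i * w = w * cs.simple j := by
  have := simple_mul_eq_mul_simple cs hA (i := i) h' (by rwa [cs.simple_mul_simple_cancel_left])
  rw [cs.simple_mul_simple_cancel_left] at this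
  conv_rhs => rw [this]
  rw [cs.simple_mul_simple_cancel_right]

/-- If the descent were lost, exchange for w⁻¹ would give sᵢ w = w sⱼ, with the left side shorter
than w and the right side not. -/
theorem isLeftDescent_mul_simple [Finite W] {w : W} {i j : B} (h : cs.IsLeftDescent w i)
    (hj : ¬ cs.IsRightDescent w j) : cs.IsLeftDescent (w * cs.simple j) i := by
  by_contra hc
  rw [← cs.isRightDescent_inv_iff] at h hc
  rw [mul_inv_rev, cs.inv_simple] at hc
  have := simple_mul_eq_mul_simple' cs hA h hc
  rw [← inv_inj, mul_inv_rev, mul_inv_rev, inv_inv, cs.inv_simple, cs.inv_simple] at this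
  rw [cs.isRightDescent_inv_iff, CoxeterSystem.IsLeftDescent] at h
  rw [CoxeterSystem.IsRightDescent, this] at hj
  exact hj h

theorem isRightDescent_simple_mul [Finite W] {w : W} {i j : B} (hi : ¬ cs.IsLeftDescent w i)
    (h : cs.IsRightDescent w j) : cs.IsRightDescent (cs.simple i * w) j := by
  by_contra hc
  have := simple_mul_eq_mul_simple' cs hA h hc
  rw [CoxeterSystem.IsLeftDescent, this] at hi
  exact hi h

theorem not_isLeftDescent_mul_simple [Finite W] {w : W} {i j : B} (h : ¬ cs.IsLeftDescent w i)
    (hne : cs.simple i * w ≠ w * cs.simple j) : ¬ cs.IsLeftDescent (w * cs.simple j) i := by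
  intro hc
  rw [← cs.isRightDescent_inv_iff] at h hc
  rw [mul_inv_rev, cs.inv_simple] at hc
  have := simple_mul_eq_mul_simple cs hA h hc
  rw [← inv_inj, mul_inv_rev, mul_inv_rev, inv_inv, cs.inv_simple, cs.inv_simple] at this
  exact hne this.symm

end

/-! ### Parabolic subgroups -/

theorem parabolic_induction_right {J : Set B} {p : W → Prop} {u : W} (hu : u ∈ parabolic cs J)
    (one : p 1) (mul : ∀ v, v ∈ parabolic cs J → ∀ j ∈ J, p v → p (v * cs.simple j)) : p u := by
  induction hu using Subgroup.closure_induction_right with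
  | one => exact one
  | mul_right x hx y hy ih =>
    obtain ⟨j, hj, rfl⟩ := hy
    exact mul x hx j hj ih
  | mul_inv_cancel x hx y hy ih =>
    obtain ⟨j, hj, rfl⟩ := hy
    rw [cs.inv_simple]
    exact mul x hx j hj ih

theorem simple_mem_parabolic {J : Set B} {j : B} (hj : j ∈ J) : cs.simple j ∈ parabolic cs J :=
  Subgroup.subset_closure ⟨j, hj, rfl⟩

theorem geomRep_parabolic_support {J : Set B} {u : W} (hu : u ∈ parabolic cs J)
    {x : RootSpace B} (hx : ∀ k ∉ J, x k = 0) : ∀ k ∉ J, geomRep cs hA u x k = 0 := by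
  refine parabolic_induction_right cs hu
    (p := fun u => ∀ x : RootSpace B, (∀ k ∉ J, x k = 0) → ∀ k ∉ J, geomRep cs hA u x k = 0)
    (fun x hx k hk => by rw [geomRep_one_apply]; exact hx k hk) ?_ x hx
  intro v _ j hj ih x hx
  rw [geomRep_mul_apply]
  refine ih _ fun k hk => ?_
  have hjk : j ≠ k := fun e => hk (e ▸ hj)
  rw [geomRep_simple_apply]
  simp [simpleRoot, hx k hk, hjk.symm]

theorem geomRep_nonneg_of_support {J : Set B} {w : W} (hw : ∀ j ∈ J, ¬ cs.IsRightDescent w j)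
    {x : RootSpace B} (hx : ∀ k ∉ J, x k = 0) (h0 : 0 ≤ x) : 0 ≤ geomRep cs hA w x := by
  have := linearMap_apply_eq_sum (geomRep cs hA w).toLinearMap x
  rw [LinearEquiv.coe_coe] at this
  rw [this]
  refine Finset.sum_nonneg fun k hk => smul_nonneg (h0 k) (geomRep_simpleRoot_nonneg cs hA (hw k ?_))
  by_contra hkJ
  exact Finsupp.mem_support_iff.1 hk (hx k hkJ)

theorem geomRep_nonpos_of_support {J : Set B} {w : W} (hw : ∀ j ∈ J, cs.IsRightDescent w j)
    {x : RootSpace B} (hx : ∀ k ∉ J, x k = 0) (h0 : 0 ≤ x) : geomRep cs hA w x ≤ 0 := by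
  have := linearMap_apply_eq_sum (geomRep cs hA w).toLinearMap x
  rw [LinearEquiv.coe_coe] at this
  rw [this]
  refine Finset.sum_nonpos fun k hk =>
    smul_nonpos_of_nonneg_of_nonpos (h0 k) (geomRep_simpleRoot_nonpos cs hA (hw k ?_))
  by_contra hkJ
  exact Finsupp.mem_support_iff.1 hk (hx k hkJ)

theorem geomRep_simpleRoot_support {J : Set B} {u : W} (hu : u ∈ parabolic cs J) {j : B}
    (hj : j ∈ J) : ∀ k ∉ J, geomRep cs hA u (simpleRoot j) k = 0 := by
  refine geomRep_parabolic_support cs hA hu fun k hk => ?_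
  have hjk : j ≠ k := fun e => hk (e ▸ hj)
  simp [simpleRoot, hjk.symm]

include hA in
/-- Lengths add for a minimal coset representative. -/
theorem length_mul_of_not_isRightDescent {J : Set B} {w u : W}
    (hw : ∀ j ∈ J, ¬ cs.IsRightDescent w j) (hu : u ∈ parabolic cs J) :
    cs.length (w * u) = cs.length w + cs.length u := by
  refine parabolic_induction_right cs hu
    (p := fun u => cs.length (w * u) = cs.length w + cs.length u) (by simp) ?_
  intro v hv j hj ih
  -- The vector v(αⱼ) has coordinates of one sign, supported on J, and w keeps that sign. So v and w
  -- v agree on whether j is a right descent.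
  have hs := geomRep_simpleRoot_support cs hA hv hj
  rw [← mul_assoc]
  by_cases h : cs.IsRightDescent v j
  · have h1 : cs.IsRightDescent (w * v) j := by
      rw [isRightDescent_iff_geomRep_nonpos cs hA, geomRep_mul_apply]
      have := geomRep_nonneg_of_support cs hA hw (x := -geomRep cs hA v (simpleRoot j))
        (fun k hk => by simp [hs k hk]) (neg_nonneg.2 (geomRep_simpleRoot_nonpos cs hA h))
      rw [map_neg] at this
      exact neg_nonneg.1 this
    rw [cs.isRightDescent_iff] at h h1
    omega
  · have h1 : ¬ cs.IsRightDescent (w * v) j := by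
      rw [not_isRightDescent_iff_geomRep_nonneg cs hA, geomRep_mul_apply]
      exact geomRep_nonneg_of_support cs hA hw hs (geomRep_simpleRoot_nonneg cs hA h)
    rw [cs.not_isRightDescent_iff] at h h1
    omega

include hA in
/-- Lengths subtract for a maximal coset representative. -/
theorem length_mul_of_isRightDescent {J : Set B} {w u : W}
    (hw : ∀ j ∈ J, cs.IsRightDescent w j) (hu : u ∈ parabolic cs J) :
    cs.length (w * u) + cs.length u = cs.length w := by
  refine parabolic_induction_right cs hu
    (p := fun u => cs.length (w * u) + cs.length u = cs.length w) (by simp) ?_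
  intro v hv j hj ih
  -- Now w reverses the sign of vectors supported on J, so the descents of v and w v at j are
  -- opposite.
  have hs := geomRep_simpleRoot_support cs hA hv hj
  rw [← mul_assoc]
  by_cases h : cs.IsRightDescent v j
  · have h1 : ¬ cs.IsRightDescent (w * v) j := by
      rw [not_isRightDescent_iff_geomRep_nonneg cs hA, geomRep_mul_apply]
      have := geomRep_nonpos_of_support cs hA hw (x := -geomRep cs hA v (simpleRoot j))
        (fun k hk => by simp [hs k hk]) (neg_nonneg.2 (geomRep_simpleRoot_nonpos cs hA h))
      rw [map_neg] at this
      exact neg_nonpos.1 this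
    rw [cs.isRightDescent_iff] at h
    rw [cs.not_isRightDescent_iff] at h1
    omega
  · have h1 : cs.IsRightDescent (w * v) j := by
      rw [isRightDescent_iff_geomRep_nonpos cs hA, geomRep_mul_apply]
      exact geomRep_nonpos_of_support cs hA hw hs (geomRep_simpleRoot_nonneg cs hA h)
    rw [cs.not_isRightDescent_iff] at h
    rw [cs.isRightDescent_iff] at h1
    omega

include hA in
-- Each of v and w is the other times an element of W_J. Lengths add in both directions, so this
-- element has length zero.
theorem eq_of_mk_eq_of_not_isRightDescent {J : Set B} {v w : W}
    (hv : ∀ j ∈ J, ¬ cs.IsRightDescent v j) (hw : ∀ j ∈ J, ¬ cs.IsRightDescent w j)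
    (h : (v : W ⧸ parabolic cs J) = w) : v = w := by
  rw [QuotientGroup.eq] at h
  have h1 := length_mul_of_not_isRightDescent cs hA hv h
  have h2 := length_mul_of_not_isRightDescent cs hA hw (inv_mem h)
  rw [mul_inv_cancel_left] at h1
  rw [mul_inv_rev, inv_inv, mul_inv_cancel_left] at h2
  have h3 : cs.length (v⁻¹ * w) = 0 := by omega
  rw [cs.length_eq_zero_iff, inv_mul_eq_one] at h3
  exact h3

/-! ### The Demazure product -/

open Classical in
/-- The map `w ↦ w.πᵢ`. -/
def demazureRight (i : B) (w : W) : W := if cs.IsRightDescent w i then w else w * cs.simple i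

open Classical in
/-- The left-handed analogue of `demazureRight`. -/
def demazureLeft (i : B) (w : W) : W := if cs.IsLeftDescent w i then w else cs.simple i * w

theorem demazureRight_of {i : B} {w : W} (h : cs.IsRightDescent w i) :
    demazureRight cs i w = w := if_pos h

theorem demazureRight_of_not {i : B} {w : W} (h : ¬ cs.IsRightDescent w i) :
    demazureRight cs i w = w * cs.simple i := if_neg h

theorem demazureLeft_of {i : B} {w : W} (h : cs.IsLeftDescent w i) :
    demazureLeft cs i w = w := if_pos h

theorem demazureLeft_of_not {i : B} {w : W} (h : ¬ cs.IsLeftDescent w i) :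
    demazureLeft cs i w = cs.simple i * w := if_neg h

theorem isRightDescent_demazureRight (i : B) (w : W) :
    cs.IsRightDescent (demazureRight cs i w) i := by
  by_cases h : cs.IsRightDescent w i
  · rwa [demazureRight_of cs h]
  · rw [demazureRight_of_not cs h]
    rw [cs.isRightDescent_iff_not_isRightDescent_mul, cs.simple_mul_simple_cancel_right]
    exact h

include hA in
-- The delicate case is when both operators want to lengthen w: either sᵢ w = w sⱼ and both orders
-- give this element, or by exchange neither step blocks the other. This commutation stands in for
-- the braid relations below.
theorem demazureLeft_demazureRight [Finite W] (i j : B) (w : W) :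
    demazureLeft cs i (demazureRight cs j w) = demazureRight cs j (demazureLeft cs i w) := by
  by_cases hi : cs.IsLeftDescent w i <;> by_cases hj : cs.IsRightDescent w j
  · simp only [demazureLeft_of cs hi, demazureRight_of cs hj]
  · simp only [demazureLeft_of cs hi, demazureRight_of_not cs hj,
      demazureLeft_of cs (isLeftDescent_mul_simple cs hA hi hj)]
  · simp only [demazureLeft_of_not cs hi, demazureRight_of cs hj,
      demazureRight_of cs (isRightDescent_simple_mul cs hA hi hj)]
  · rw [demazureLeft_of_not cs hi, demazureRight_of_not cs hj]
    by_cases he : cs.simple i * w = w * cs.simple j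
    · rw [demazureLeft_of, demazureRight_of, he]
      · rw [he, cs.isRightDescent_iff_not_isRightDescent_mul, cs.simple_mul_simple_cancel_right]
        exact hj
      · rw [← he, cs.isLeftDescent_iff_not_isLeftDescent_mul, cs.simple_mul_simple_cancel_left]
        exact hi
    · rw [demazureLeft_of_not _ (not_isLeftDescent_mul_simple cs hA hi he), demazureRight_of_not,
        mul_assoc]
      exact fun hc => he (simple_mul_eq_mul_simple cs hA hj hc)

/-- The map `w ↦ w.π_{i₁}⋯π_{iᵣ}`. -/
def demazureRightWord (l : List B) (w : W) : W := l.foldl (fun v i => demazureRight cs i v) w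

/-- The left-handed analogue of `demazureRightWord`. -/
def demazureLeftWord (l : List B) (w : W) : W := l.foldr (demazureLeft cs) w

theorem demazureRightWord_cons (i : B) (l : List B) (w : W) :
    demazureRightWord cs (i :: l) w = demazureRightWord cs l (demazureRight cs i w) := rfl

theorem demazureLeftWord_cons (i : B) (l : List B) (w : W) :
    demazureLeftWord cs (i :: l) w = demazureLeft cs i (demazureLeftWord cs l w) := rfl

include hA in
theorem demazureLeft_demazureRightWord [Finite W] (i : B) (l : List B) (w : W) :
    demazureLeft cs i (demazureRightWord cs l w) =
      demazureRightWord cs l (demazureLeft cs i w) := by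
  induction l generalizing w with
  | nil => rfl
  | cons j l ih => rw [demazureRightWord_cons, ih, demazureLeft_demazureRight cs hA]; rfl

include hA in
theorem demazureLeftWord_demazureRightWord [Finite W] (l l' : List B) (w : W) :
    demazureLeftWord cs l (demazureRightWord cs l' w) =
      demazureRightWord cs l' (demazureLeftWord cs l w) := by
  induction l with
  | nil => rfl
  | cons i l ih =>
    rw [demazureLeftWord_cons, ih, demazureLeft_demazureRightWord cs hA, demazureLeftWord_cons]

theorem demazureLeftWord_one {l : List B} (hl : cs.IsReduced l) :
    demazureLeftWord cs l 1 = cs.wordProd l := by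
  induction l with
  | nil => simp [demazureLeftWord]
  | cons i l ih =>
    have hl' : cs.IsReduced l := by simpa using hl.drop 1
    rw [demazureLeftWord_cons, ih hl', cs.wordProd_cons, demazureLeft_of_not]
    rw [cs.not_isLeftDescent_iff, ← cs.wordProd_cons, hl.eq, hl'.eq, List.length_cons]

theorem demazureRightWord_one {l : List B} (hl : cs.IsReduced l) :
    demazureRightWord cs l 1 = cs.wordProd l := by
  induction l using List.reverseRecOn with
  | nil => simp [demazureRightWord]
  | append_singleton l i ih =>
    have hl' : cs.IsReduced l := by simpa using hl.take l.length
    have h1 : demazureRightWord cs (l ++ [i]) 1 =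
        demazureRight cs i (demazureRightWord cs l 1) := by
      simp [demazureRightWord, List.foldl_append]
    rw [h1, ih hl', cs.wordProd_append, cs.wordProd_singleton, demazureRight_of_not]
    rw [cs.not_isRightDescent_iff, ← cs.wordProd_singleton, ← cs.wordProd_append, hl.eq, hl'.eq,
      List.length_append, List.length_singleton]

include hA in
-- Both sides are l on the left and l' on the right, applied to 1. The left side sees l only through
-- its product, the right side sees l' only through its product, so w.π_t does not depend on reduced
-- words.
theorem demazureRightWord_eq_demazureLeftWord [Finite W] {l l' : List B} (hl : cs.IsReduced l)
    (hl' : cs.IsReduced l') :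
    demazureRightWord cs l' (cs.wordProd l) = demazureLeftWord cs l (cs.wordProd l') := by
  rw [← demazureLeftWord_one cs hl, ← demazureRightWord_one cs hl',
    demazureLeftWord_demazureRightWord cs hA]

/-- The map `w ↦ w.π_t`, by a chosen reduced word of `t`. -/
def demazureElt (t : W) (w : W) : W := demazureRightWord cs (cs.exists_isReduced t).choose w

include hA in
theorem demazureElt_eq [Finite W] {l : List B} (hl : cs.IsReduced l) (w : W) :
    demazureElt cs (cs.wordProd l) w = demazureRightWord cs l w := by
  obtain ⟨h1, h2⟩ := (cs.exists_isReduced (cs.wordProd l)).choose_spec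
  obtain ⟨l', hl', rfl⟩ := cs.exists_isReduced w
  rw [demazureElt, demazureRightWord_eq_demazureLeftWord cs hA hl' h1, ← h2,
    demazureRightWord_eq_demazureLeftWord cs hA hl' hl]

include hA in
theorem demazureElt_wordProd [Finite W] (t : W) {l : List B} (hl : cs.IsReduced l) :
    demazureElt cs t (cs.wordProd l) = demazureLeftWord cs l t := by
  obtain ⟨l', hl', rfl⟩ := cs.exists_isReduced t
  rw [demazureElt_eq cs hA hl', demazureRightWord_eq_demazureLeftWord cs hA hl hl']

include hA in
-- Some reduced word of t begins with i, and πᵢ is idempotent.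
theorem demazureElt_demazureRight [Finite W] {t : W} {i : B} (hi : cs.IsLeftDescent t i) (w : W) :
    demazureElt cs t (demazureRight cs i w) = demazureElt cs t w := by
  obtain ⟨l, hl, hlt⟩ := cs.exists_isReduced (cs.simple i * t)
  have ht : t = cs.wordProd (i :: l) := by
    rw [cs.wordProd_cons, ← hlt, cs.simple_mul_simple_cancel_left]
  have hr : cs.IsReduced (i :: l) := by
    have h1 := cs.isLeftDescent_iff.1 hi
    rw [hlt, hl.eq] at h1
    rw [CoxeterSystem.IsReduced, ← ht, List.length_cons, h1]
  rw [ht, demazureElt_eq cs hA hr, demazureElt_eq cs hA hr, demazureRightWord_cons,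
    demazureRightWord_cons, demazureRight_of cs (isRightDescent_demazureRight cs i w)]

include hA in
theorem demazureElt_mul_simple [Finite W] {t : W} {i : B} (hi : cs.IsLeftDescent t i) (w : W) :
    demazureElt cs t (w * cs.simple i) = demazureElt cs t w := by
  by_cases h : cs.IsRightDescent w i
  · rw [← demazureElt_demazureRight cs hA hi (w * cs.simple i), demazureRight_of_not,
      cs.simple_mul_simple_cancel_right]
    exact cs.isRightDescent_iff_not_isRightDescent_mul.1 h
  · rw [← demazureRight_of_not cs h, demazureElt_demazureRight cs hA hi]

include hA in
theorem demazureElt_of_mem_parabolic [Finite W] {t u : W}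
    (hu : u ∈ parabolic cs (leftDescents cs t)) : demazureElt cs t u = t := by
  refine parabolic_induction_right cs hu (p := fun u => demazureElt cs t u = t) ?_ ?_
  · have h := demazureElt_wordProd cs hA t (l := []) (by simp [CoxeterSystem.IsReduced])
    simpa [demazureLeftWord] using h
  · intro v _ j hj ih
    rw [demazureElt_mul_simple cs hA hj, ih]

/-- A left Demazure operator never shortens. As long as t has not moved, every letter applied was a
left descent of t. -/
theorem length_demazureLeftWord (l : List B) (t : W) :
    cs.length t < cs.length (demazureLeftWord cs l t) ∨
      demazureLeftWord cs l t = t ∧ cs.wordProd l ∈ parabolic cs (leftDescents cs t) := by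
  induction l with
  | nil => exact Or.inr ⟨rfl, by rw [cs.wordProd_nil]; exact one_mem _⟩
  | cons i l ih =>
    rw [demazureLeftWord_cons, cs.wordProd_cons]
    rcases ih with h | ⟨h1, h2⟩
    · refine Or.inl (h.trans_le ?_)
      by_cases hd : cs.IsLeftDescent (demazureLeftWord cs l t) i
      · rw [demazureLeft_of cs hd]
      · rw [demazureLeft_of_not cs hd, cs.not_isLeftDescent_iff.1 hd]
        exact Nat.le_succ _
    · rw [h1]
      by_cases hd : cs.IsLeftDescent t i
      · exact Or.inr ⟨demazureLeft_of cs hd, mul_mem (simple_mem_parabolic cs hd) h2⟩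
      · left
        rw [demazureLeft_of_not cs hd, cs.not_isLeftDescent_iff.1 hd]
        exact Nat.lt_succ_self _

include hA in
theorem length_demazureElt [Finite W] (t w : W) :
    cs.length t < cs.length (demazureElt cs t w) ∨
      demazureElt cs t w = t ∧ w ∈ parabolic cs (leftDescents cs t) := by
  obtain ⟨l, hl, rfl⟩ := cs.exists_isReduced w
  rw [demazureElt_wordProd cs hA t hl]
  exact length_demazureLeftWord cs l t

/-! ### The operators -/

omit [Group W] in
theorem opOf_mul (f g : W → W) : opOf f * opOf g = opOf fun w => g (f w) := by
  rw [opOf, opOf, opOf, ← MulOpposite.op_mul]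
  exact congrArg MulOpposite.op (Finsupp.lmapDomain_comp ℂ ℂ f g).symm

omit [Group W] in
theorem opOf_id : opOf (fun w : W => w) = 1 := by
  rw [opOf, ← MulOpposite.op_one]
  exact congrArg MulOpposite.op (Finsupp.lmapDomain_id ℂ ℂ)

omit [Group W] in
theorem opOf_unop_single (f : W → W) (w : W) (a : ℂ) :
    (opOf f).unop (Finsupp.single w a) = Finsupp.single (f w) a := by
  simp [opOf]

theorem simplePi_eq (i : B) : simplePi cs i = opOf (demazureRight cs i) := rfl

theorem prod_map_simplePi (l : List B) :
    (l.map (simplePi cs)).prod = opOf (demazureRightWord cs l) := by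
  induction l with
  | nil => exact opOf_id.symm
  | cons i l ih => rw [List.map_cons, List.prod_cons, ih, simplePi_eq, opOf_mul]; rfl

theorem piElt_eq (t : W) : piElt cs t = opOf (demazureElt cs t) := prod_map_simplePi cs _

theorem rightMul_mul (v w : W) : rightMul v * rightMul w = rightMul (v * w) := by
  rw [rightMul, rightMul, opOf_mul, rightMul]
  simp only [mul_assoc]

theorem rightMul_mem_heckeGroupAlgebra (w : W) : rightMul w ∈ heckeGroupAlgebra cs := by
  refine cs.simple_induction_right (p := fun w => rightMul w ∈ heckeGroupAlgebra cs) w ?_ fun w i h => ?_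
  · have : rightMul (1 : W) = 1 := by simp only [rightMul, mul_one]; exact opOf_id
    rw [this]
    exact one_mem _
  · rw [← rightMul_mul]
    exact mul_mem h (Algebra.subset_adjoin (Or.inl ⟨i, rfl⟩))

theorem simplePi_mem_heckeGroupAlgebra (i : B) : simplePi cs i ∈ heckeGroupAlgebra cs :=
  Algebra.subset_adjoin (Or.inr ⟨i, rfl⟩)

theorem piElt_mem_heckeGroupAlgebra (t : W) : piElt cs t ∈ heckeGroupAlgebra cs := by
  refine list_prod_mem fun x hx => ?_
  obtain ⟨i, -, rfl⟩ := List.mem_map.1 hx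
  exact simplePi_mem_heckeGroupAlgebra cs i

/-- For α = w(αᵢ), the operator π_α is the conjugate w πᵢ w⁻¹. The same chosen w and i define
`rootReflection`, so no independence of the choice is needed. -/
theorem opOf_rootProj_mem_heckeGroupAlgebra (α : Root cs hA) :
    opOf (rootProj cs hA α) ∈ heckeGroupAlgebra cs := by
  have hα : geomRep cs hA α.2.choose (simpleRoot α.2.choose_spec.choose) = α.1 :=
    α.2.choose_spec.choose_spec
  have : opOf (rootProj cs hA α) = rightMul α.2.choose *
      simplePi cs α.2.choose_spec.choose * rightMul (α.2.choose)⁻¹ := by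
    rw [simplePi_eq, rightMul, rightMul, opOf_mul, opOf_mul]
    congr 1
    funext w
    have h1 : IsPositive (geomRep cs hA w α.1) ↔
        ¬ cs.IsRightDescent (w * α.2.choose) α.2.choose_spec.choose := by
      rw [← isPositive_geomRep_iff cs hA, geomRep_mul_apply, hα]
    by_cases h : cs.IsRightDescent (w * α.2.choose) α.2.choose_spec.choose
    · rw [demazureRight_of cs h, rootProj, if_neg (by rw [h1]; exact not_not.2 h),
        mul_inv_cancel_right]
    · rw [demazureRight_of_not cs h, rootProj, if_pos (h1.2 h), rootReflection]
      simp only [mul_assoc]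
  rw [this]
  exact mul_mem (mul_mem (rightMul_mem_heckeGroupAlgebra cs _)
    (simplePi_mem_heckeGroupAlgebra cs _)) (rightMul_mem_heckeGroupAlgebra cs _)

theorem nabla_unop_apply (α : Root cs hA) (v : W →₀ ℂ) :
    (nabla cs hA α).unop v = (opOf (rootProj cs hA α)).unop v - v := rfl

theorem nabla_eq (α : Root cs hA) :
    nabla cs hA α = opOf (rootProj cs hA α) + (-1 : ℂ) • 1 := by
  apply MulOpposite.unop_injective
  refine LinearMap.ext fun v => ?_
  rw [nabla_unop_apply, MulOpposite.unop_add, LinearMap.add_apply, MulOpposite.unop_smul,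
    LinearMap.smul_apply, neg_one_smul, ← sub_eq_add_neg]
  rfl

theorem nablaWord_mem_heckeGroupAlgebra {S : Set (Root cs hA)} (l : List S) :
    nablaWord cs hA l ∈ heckeGroupAlgebra cs := by
  refine list_prod_mem fun x hx => ?_
  obtain ⟨α, -, rfl⟩ := List.mem_map.1 hx
  rw [nabla_eq]
  exact add_mem (opOf_rootProj_mem_heckeGroupAlgebra cs hA _)
    (Subalgebra.smul_mem _ (one_mem _) _)

/-! ### Left antisymmetries -/

/-- The operator of left multiplication by `sᵢ`. -/
def leftSimple (i : B) : (W →₀ ℂ) →ₗ[ℂ] (W →₀ ℂ) :=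
  Finsupp.lmapDomain ℂ ℂ fun w => cs.simple i * w

theorem leftSimple_single (i : B) (w : W) (a : ℂ) :
    leftSimple cs i (Finsupp.single w a) = Finsupp.single (cs.simple i * w) a := by
  simp [leftSimple]

theorem leftSimple_apply (i : B) (v : W →₀ ℂ) (w : W) :
    leftSimple cs i v w = v (cs.simple i * w) := by
  have hinj : Function.Injective fun w => cs.simple i * w := mul_right_injective _
  conv_lhs => rw [← cs.simple_mul_simple_cancel_left (w := w) i]
  exact Finsupp.mapDomain_apply hinj v (cs.simple i * w)

/-- The operators preserving all left antisymmetries `{v | sᵢ v = -v}`. -/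
def PreservesAntisymmetry (f : RightEnd W) : Prop :=
  ∀ (i : B) (v : W →₀ ℂ), leftSimple cs i v = -v → leftSimple cs i (f.unop v) = -f.unop v

include hA in
-- If only one of w and sᵢ w has j as a right descent, exchange gives sᵢ w = w sⱼ, and πⱼ merges the
-- two elements.
theorem demazureRight_simple_mul [Finite W] (i j : B) (w : W) :
    demazureRight cs j (cs.simple i * w) = cs.simple i * demazureRight cs j w ∨
      demazureRight cs j (cs.simple i * w) = demazureRight cs j w := by
  by_cases h : cs.IsRightDescent w j <;> by_cases h' : cs.IsRightDescent (cs.simple i * w) j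
  · rw [demazureRight_of cs h, demazureRight_of cs h']; exact Or.inl rfl
  · right
    rw [demazureRight_of cs h, demazureRight_of_not cs h', simple_mul_eq_mul_simple' cs hA h h',
      cs.simple_mul_simple_cancel_right]
  · right
    rw [demazureRight_of_not cs h, demazureRight_of cs h', simple_mul_eq_mul_simple cs hA h h']
  · left
    rw [demazureRight_of_not cs h, demazureRight_of_not cs h', mul_assoc]

theorem preservesAntisymmetry_rightMul (w : W) : PreservesAntisymmetry cs (rightMul w) := by
  intro i v hv
  have h : ∀ v, leftSimple cs i ((rightMul w).unop v) = (rightMul w).unop (leftSimple cs i v) := by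
    intro v
    induction v using Finsupp.induction_linear with
    | zero => simp
    | add f g hf hg => simp only [map_add, hf, hg]
    | single x a =>
      rw [rightMul, opOf_unop_single, leftSimple_single, leftSimple_single, opOf_unop_single,
        mul_assoc]
  rw [h, hv, map_neg]

include hA in
-- The operator πⱼ sends x - sᵢ x to a difference of the same kind or to zero, and an antisymmetric
-- v is half of v - sᵢ v.
theorem preservesAntisymmetry_simplePi [Finite W] (j : B) :
    PreservesAntisymmetry cs (simplePi cs j) := by
  intro i v hv
  have h : ∀ v, leftSimple cs i ((simplePi cs j).unop (v - leftSimple cs i v)) =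
      -(simplePi cs j).unop (v - leftSimple cs i v) := by
    intro v
    induction v using Finsupp.induction_linear with
    | zero => simp
    | add f g hf hg =>
      have : f + g - leftSimple cs i (f + g) =
          (f - leftSimple cs i f) + (g - leftSimple cs i g) := by rw [map_add]; abel
      rw [this, map_add, map_add, hf, hg]
      abel
    | single x a =>
      rw [leftSimple_single, map_sub, simplePi_eq, opOf_unop_single, opOf_unop_single, map_sub,
        leftSimple_single, leftSimple_single]
      rcases demazureRight_simple_mul cs hA i j x with h | h
      · rw [h, cs.simple_mul_simple_cancel_left, neg_sub]
      · rw [h, sub_self, sub_self, neg_zero]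
  have h2 : v - leftSimple cs i v = (2 : ℂ) • v := by rw [hv, two_smul]; abel
  have h3 := h v
  rw [h2, map_smul, map_smul, ← smul_neg] at h3
  exact smul_right_injective _ (two_ne_zero (α := ℂ)) h3

include hA in
theorem preservesAntisymmetry_of_mem [Finite W] {f : RightEnd W}
    (hf : f ∈ heckeGroupAlgebra cs) : PreservesAntisymmetry cs f := by
  induction hf using Algebra.adjoin_induction with
  | mem f hf =>
    rcases hf with ⟨i, rfl⟩ | ⟨i, rfl⟩
    · exact preservesAntisymmetry_rightMul cs _
    · exact preservesAntisymmetry_simplePi cs hA i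
  | algebraMap r =>
    intro i v hv
    rw [MulOpposite.algebraMap_apply, MulOpposite.unop_op, Module.algebraMap_end_apply, map_smul,
      hv, smul_neg]
  | add f g _ _ hf hg =>
    intro i v hv
    rw [MulOpposite.unop_add, LinearMap.add_apply, map_add, hf i v hv, hg i v hv, neg_add]
  | mul f g _ _ hf hg =>
    intro i v hv
    rw [MulOpposite.unop_mul, Module.End.mul_apply]
    exact hg i _ (hf i v hv)

/-- The alternating sum `∑ (-1)^ℓ(u) u t` over `u ∈ W_J`. -/
def alternatingSum (J : Set B) (t : W) : W →₀ ℂ :=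
  ∑ᶠ u : parabolic cs J, Finsupp.single (u.1 * t) ((-1) ^ cs.length u.1)

theorem leftSimple_alternatingSum [Finite W] {J : Set B} {i : B} (hi : i ∈ J) (t : W) :
    leftSimple cs i (alternatingSum cs J t) = -alternatingSum cs J t := by
  classical
  have := Fintype.ofFinite (parabolic cs J)
  rw [alternatingSum, finsum_eq_sum_of_fintype, map_sum, ← Finset.sum_neg_distrib]
  refine Fintype.sum_equiv (Equiv.mulLeft ⟨cs.simple i, simple_mem_parabolic cs hi⟩) _ _ ?_
  intro u
  rw [leftSimple_single, ← Finsupp.single_neg]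
  simp only [Equiv.coe_mulLeft, Subgroup.coe_mul, mul_assoc]
  congr 1
  rcases cs.length_simple_mul u.1 i with h | h
  · rw [h, pow_succ]; ring
  · rw [← h, pow_succ]; ring

include hA in
-- The element t is the longest of W_J t for J = D_L(t), so the sum is t plus a combination of
-- shorter elements; induction on length recovers the value at t.
theorem eq_zero_of_alternatingSum [Finite W] (f : (W →₀ ℂ) →ₗ[ℂ] (W →₀ ℂ))
    (h : ∀ t, f (alternatingSum cs (leftDescents cs t) t) = 0) : f = 0 := by
  classical
  suffices hs : ∀ t, f (Finsupp.single t 1) = 0 by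
    ext t : 2
    exact hs t
  intro t
  induction hn : cs.length t using Nat.strong_induction_on generalizing t with
  | _ n ih =>
  subst hn
  have := Fintype.ofFinite (parabolic cs (leftDescents cs t))
  have h1 := h t
  rw [alternatingSum, finsum_eq_sum_of_fintype, map_sum, Finset.sum_eq_single 1] at h1
  · simpa using h1
  · rintro ⟨u, hu⟩ - hne
    have hu1 : u ≠ 1 := fun e => hne (Subtype.ext e)
    have hlen := length_mul_of_isRightDescent cs hA (w := t⁻¹) (J := leftDescents cs t)
      (fun j hj => cs.isRightDescent_inv_iff.2 hj) (inv_mem hu)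
    rw [← mul_inv_rev, cs.length_inv, cs.length_inv, cs.length_inv] at hlen
    have hpos : cs.length u ≠ 0 := fun e => hu1 (cs.length_eq_zero_iff.1 e)
    have h2 := ih (cs.length (u * t)) (by omega) (u * t) rfl
    change f (Finsupp.single (u * t) _) = 0
    rw [← Finsupp.smul_single_one, map_smul, h2, smul_zero]
  · intro hne
    exact absurd (Finset.mem_univ _) hne

/-- Antisymmetry relates the coefficients at w and sᵢ w up to sign, and descending by J leads to a
minimal element of W_J w. -/
theorem eq_zero_of_antisymmetric {J : Set B} {v : W →₀ ℂ}
    (hv : ∀ i ∈ J, leftSimple cs i v = -v)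
    (h0 : ∀ w, (∀ i ∈ J, ¬ cs.IsLeftDescent w i) → v w = 0) : v = 0 := by
  ext w
  induction hn : cs.length w using Nat.strong_induction_on generalizing w with
  | _ n ih =>
  subst hn
  by_cases h : ∀ i ∈ J, ¬ cs.IsLeftDescent w i
  · exact h0 w h
  · push Not at h
    obtain ⟨i, hi, hd⟩ := h
    have h1 := leftSimple_apply cs i v w
    rw [hv i hi, ih _ hd (cs.simple i * w) rfl] at h1
    simpa using h1

/-! ### The dimension bound -/

/-- The coefficients of an operator that determine it if it preserves antisymmetries. -/
def antisymmetryCoeff : RightEnd W →ₗ[ℂ] (BasisIndex cs → ℂ) where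
  -- The condition on the pair (w, t) says that w⁻¹ is minimal in W_J w⁻¹ for J = D_L(t).
  toFun f p := f.unop (alternatingSum cs (leftDescents cs p.1.2) p.1.2) (p.1.1)⁻¹
  map_add' f g := by ext p; simp
  map_smul' c f := by ext p; simp

include hA in
theorem eq_zero_of_antisymmetryCoeff_eq_zero [Finite W] {f : RightEnd W}
    (hf : PreservesAntisymmetry cs f) (h : antisymmetryCoeff cs f = 0) : f = 0 := by
  rw [← MulOpposite.unop_eq_zero_iff]
  refine eq_zero_of_alternatingSum cs hA _ fun t => ?_
  refine eq_zero_of_antisymmetric cs (J := leftDescents cs t)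
    (fun i hi => hf i _ (leftSimple_alternatingSum cs hi t)) fun w hw => ?_
  have h1 := congrFun h ⟨(w⁻¹, t), by
    rw [Set.eq_empty_iff_forall_notMem]
    rintro i ⟨h1, h2⟩
    exact hw i h2 (cs.isRightDescent_inv_iff.1 h1)⟩
  simpa [antisymmetryCoeff] using h1

include hA in
theorem injective_antisymmetryCoeff_comp_subtype [Finite W] :
    Function.Injective
      ((antisymmetryCoeff cs).comp (heckeGroupAlgebra cs).toSubmodule.subtype) := by
  rintro ⟨f, hf⟩ ⟨g, hg⟩ h
  change antisymmetryCoeff cs f = antisymmetryCoeff cs g at h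
  have h0 := eq_zero_of_antisymmetryCoeff_eq_zero cs hA (f := f + (-1 : ℂ) • g)
    (preservesAntisymmetry_of_mem cs hA (add_mem hf (Subalgebra.smul_mem _ hg _)))
    (by rw [map_add, map_smul, h, neg_one_smul, add_neg_cancel])
  refine Subtype.ext (MulOpposite.unop_injective (LinearMap.ext fun v => ?_))
  have h1 := congrArg (fun k : RightEnd W => k.unop v) h0
  change f.unop v + (-1 : ℂ) • g.unop v = 0 at h1
  rw [neg_one_smul] at h1
  exact add_neg_eq_zero.1 h1

/-! ### Triangularity -/

open Classical in
/-- The sum of the coefficients at the elements of `W_J`. -/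
def parabolicCoeff (J : Set B) : (W →₀ ℂ) →ₗ[ℂ] ℂ :=
  Finsupp.linearCombination ℂ fun w => if w ∈ parabolic cs J then 1 else 0

theorem parabolicCoeff_of_mem {J : Set B} {w : W} (h : w ∈ parabolic cs J) :
    parabolicCoeff cs J (Finsupp.single w 1) = 1 := by
  simp [parabolicCoeff, h]

theorem parabolicCoeff_of_notMem {J : Set B} {w : W} (h : w ∉ parabolic cs J) :
    parabolicCoeff cs J (Finsupp.single w 1) = 0 := by
  simp [parabolicCoeff, h]

include hA in
-- Elements of W_J, J = D_L(t), are sent to t; all others go to elements longer than t and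
-- contribute nothing.
theorem piElt_unop_apply_self [Finite W] (t : W) (v : W →₀ ℂ) :
    (piElt cs t).unop v t = parabolicCoeff cs (leftDescents cs t) v := by
  induction v using Finsupp.induction_linear with
  | zero => simp
  | add f g hf hg => rw [map_add, Finsupp.add_apply, hf, hg, map_add]
  | single x a =>
    rw [← Finsupp.smul_single_one, map_smul, map_smul, Finsupp.smul_apply]
    congr 1
    rw [piElt_eq, opOf_unop_single]
    by_cases h : x ∈ parabolic cs (leftDescents cs t)
    · rw [parabolicCoeff_of_mem cs h, demazureElt_of_mem_parabolic cs hA h, Finsupp.single_eq_same]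
    · rw [parabolicCoeff_of_notMem cs h, Finsupp.single_eq_of_ne']
      intro e
      rcases length_demazureElt cs hA t x with h1 | h1
      · rw [e] at h1
        exact lt_irrefl _ h1
      · exact h h1.2

include hA in
theorem piElt_unop_apply_of_length_le [Finite W] {t t' : W} (hne : t' ≠ t)
    (hle : cs.length t ≤ cs.length t') (v : W →₀ ℂ) : (piElt cs t').unop v t = 0 := by
  induction v using Finsupp.induction_linear with
  | zero => simp
  | add f g hf hg => rw [map_add, Finsupp.add_apply, hf, hg, add_zero]
  | single x a =>
    rw [piElt_eq, opOf_unop_single, Finsupp.single_eq_of_ne']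
    intro e
    rcases length_demazureElt cs hA t' x with h1 | h1
    · rw [e] at h1
      exact absurd h1 (by omega)
    · exact hne (h1.1.symm.trans e)

/-! ### Products of the ∇_β and reduced words -/

variable {cs hA} {S : Set (Root cs hA)}

theorem nablaWord_cons_unop_single (α : S) (l : List S) (w : W) :
    (nablaWord cs hA (α :: l)).unop (Finsupp.single w 1) =
      (nablaWord cs hA l).unop (Finsupp.single (rootProj cs hA α.1 w) 1) -
        (nablaWord cs hA l).unop (Finsupp.single w 1) := by
  rw [nablaWord, List.map_cons, List.prod_cons, MulOpposite.unop_mul, Module.End.mul_apply,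
    nabla_unop_apply, opOf_unop_single, map_sub]
  rfl

theorem rootProjWord_cons (w : W) (α : S) (l : List S) :
    rootProjWord cs hA w (α :: l) = rootProjWord cs hA (rootProj cs hA α.1 w) l := rfl

open Classical in
/-- Only the full word contributes to the expansion of `∇_{α₁}⋯∇_{αᵣ}` if no shorter word
reaches `W_J`. -/
theorem parabolicCoeff_nablaWord {J : Set B} (l : List S) (w : W)
    (h : ∀ l' : List S, l'.length < l.length → rootProjWord cs hA w l' ∉ parabolic cs J) :
    parabolicCoeff cs J ((nablaWord cs hA l).unop (Finsupp.single w 1)) =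
      if rootProjWord cs hA w l ∈ parabolic cs J then 1 else 0 := by
  induction l generalizing w with
  | nil =>
    have : (nablaWord cs hA ([] : List S)).unop (Finsupp.single w 1) = Finsupp.single w 1 := rfl
    rw [this]
    split_ifs with hw
    · exact parabolicCoeff_of_mem cs hw
    · exact parabolicCoeff_of_notMem cs hw
  | cons α l ih =>
    -- The branch -1 of ∇_α applies the shorter word l to w itself, and this cannot reach W_J.
    rw [nablaWord_cons_unop_single, map_sub, ih, ih, rootProjWord_cons,
      if_neg (h l (by simp)), sub_zero]
    · exact fun l' hl' => h l' (hl'.trans (by simp))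
    · intro l' hl'
      rw [← rootProjWord_cons]
      exact h (α :: l') (by simpa using hl')

/-- A letter acting trivially could be dropped, giving a shorter word that still reaches W_J. So
every letter acts as its reflection. -/
theorem rootProjWord_eq_mul_prod {J : Set B} (l : List S) (w : W)
    (h : ∀ l' : List S, l'.length < l.length → rootProjWord cs hA w l' ∉ parabolic cs J)
    (hl : rootProjWord cs hA w l ∈ parabolic cs J) :
    rootProjWord cs hA w l = w * (l.map fun α => rootReflection cs hA α.1).prod := by
  induction l generalizing w with
  | nil => simp [rootProjWord]
  | cons α l ih =>
    rw [rootProjWord_cons] at hl ⊢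
    rw [ih _ _ hl, List.map_cons, List.prod_cons, ← mul_assoc]
    · congr 1
      by_cases hp : IsPositive (geomRep cs hA w α.1.1)
      · rw [rootProj, if_pos hp]
      · rw [rootProj, if_neg hp] at hl
        exact absurd hl (h l (by simp))
    · intro l' hl'
      rw [← rootProjWord_cons]
      exact h (α :: l') (by simpa using hl')

/-- No word shorter than a reduced word of `w⁻¹ W_J` carries `w` into `W_J`. -/
theorem IsReducedWordFor.rootProjWord_notMem {J : Set B} {w : W} {l : List S}
    (hl : IsReducedWordFor cs hA J ((w⁻¹ : W) : W ⧸ parabolic cs J) l) {l' : List S}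
    (hlt : l'.length < l.length) : rootProjWord cs hA w l' ∉ parabolic cs J :=
  fun h => hlt.not_ge (hl.2 l' ⟨w, _, rfl, h, rfl⟩)

/-- The product of reflections carries ν into W_J, so it lies in ν⁻¹ W_J. Hence a reduced word by
itself determines the coset it sorts. -/
theorem IsReducedWordFor.mk_prod_eq {J : Set B} {c : W ⧸ parabolic cs J} {l : List S}
    (hl : IsReducedWordFor cs hA J c l) :
    (((l.map fun α => rootReflection cs hA α.1).prod : W) : W ⧸ parabolic cs J) = c := by
  obtain ⟨ν, μ, rfl, hμ, rfl⟩ := hl.1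
  have h := rootProjWord_eq_mul_prod l ν (fun l' hl' => hl.rootProjWord_notMem hl') hμ
  rw [h] at hμ
  rw [eq_comm, QuotientGroup.eq, inv_inv]
  exact hμ

theorem IsReducedWordFor.exists_parabolicCoeff_eq_one {J : Set B} {c : W ⧸ parabolic cs J}
    {l : List S} (hl : IsReducedWordFor cs hA J c l) :
    ∃ w : W, ((w⁻¹ : W) : W ⧸ parabolic cs J) = c ∧
      parabolicCoeff cs J ((nablaWord cs hA l).unop (Finsupp.single w 1)) = 1 := by
  obtain ⟨ν, μ, rfl, hμ, rfl⟩ := hl.1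
  refine ⟨ν, rfl, ?_⟩
  rw [parabolicCoeff_nablaWord l ν fun l' hl' => hl.rootProjWord_notMem hl', if_pos hμ]

/-- No word shorter than l carries w into W_J, so only the full word l could contribute. If it did,
its product of reflections would lie in w⁻¹ W_J, whereas it lies in c. -/
theorem IsReducedWordFor.parabolicCoeff_eq_zero {J : Set B} {c : W ⧸ parabolic cs J}
    {l l' : List S} {w : W} (hl : IsReducedWordFor cs hA J c l)
    (hl' : IsReducedWordFor cs hA J ((w⁻¹ : W) : W ⧸ parabolic cs J) l')
    (hne : ((w⁻¹ : W) : W ⧸ parabolic cs J) ≠ c) (hle : l.length ≤ l'.length) :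
    parabolicCoeff cs J ((nablaWord cs hA l).unop (Finsupp.single w 1)) = 0 := by
  have h := fun (l'' : List S) (hlt : l''.length < l.length) =>
    hl'.rootProjWord_notMem (hlt.trans_le hle)
  rw [parabolicCoeff_nablaWord l w h, if_neg]
  intro hμ
  rw [rootProjWord_eq_mul_prod l w h hμ] at hμ
  apply hne
  rw [← hl.mk_prod_eq, QuotientGroup.eq, inv_inv]
  exact hμ

/-! ### Linear independence of the family -/

variable (cs hA)

/-- The element `∇_{w W_{D_L(t)}} π_t` of the Hecke group algebra. -/
def nablaPi (word : ∀ J : Set B, (W ⧸ parabolic cs J) → List S) (p : BasisIndex cs) :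
    heckeGroupAlgebra cs :=
  ⟨nablaWord cs hA (word (leftDescents cs p.1.2) p.1.1) * piElt cs p.1.2,
    mul_mem (nablaWord_mem_heckeGroupAlgebra cs hA _) (piElt_mem_heckeGroupAlgebra cs _)⟩

/-- The coefficient of `t` in `w.f`, as a linear form in `f`. -/
def matrixCoeff (w t : W) : heckeGroupAlgebra cs →ₗ[ℂ] ℂ where
  toFun f := f.1.unop (Finsupp.single w 1) t
  map_add' f g := by simp
  map_smul' c f := by simp

variable {cs hA}

theorem matrixCoeff_nablaPi_of_length_le [Finite W]
    (word : ∀ J : Set B, (W ⧸ parabolic cs J) → List S) {p : BasisIndex cs} {t : W}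
    (hne : p.1.2 ≠ t) (hle : cs.length t ≤ cs.length p.1.2) (w : W) :
    matrixCoeff cs w t (nablaPi cs hA word p) = 0 :=
  piElt_unop_apply_of_length_le cs hA hne hle _

theorem matrixCoeff_nablaPi_self [Finite W]
    (word : ∀ J : Set B, (W ⧸ parabolic cs J) → List S) (p : BasisIndex cs) (w : W) :
    matrixCoeff cs w p.1.2 (nablaPi cs hA word p) =
      parabolicCoeff cs (leftDescents cs p.1.2)
        ((nablaWord cs hA (word (leftDescents cs p.1.2) p.1.1)).unop (Finsupp.single w 1)) :=
  piElt_unop_apply_self cs hA _ _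

theorem BasisIndex.not_isRightDescent (p : BasisIndex cs) :
    ∀ j ∈ leftDescents cs p.1.2, ¬ cs.IsRightDescent p.1.1 j := by
  intro j hj h
  have : j ∈ rightDescents cs p.1.1 ∩ leftDescents cs p.1.2 := ⟨h, hj⟩
  rw [p.2] at this
  exact this

/-- Among the pairs with nonzero coefficient take t of minimal length, then for this t a pair with
the longest word. The coefficient of t at a suitable ν with ν⁻¹ ∈ w W_J isolates this pair: terms
with another t' vanish by length, terms with the same t by the maximality of the word. -/
theorem eq_zero_of_sum_nablaPi [Finite W] [Fintype (BasisIndex cs)]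
    (word : ∀ J : Set B, (W ⧸ parabolic cs J) → List S)
    (hword : ∀ (J : Set B) (c : W ⧸ parabolic cs J), IsReducedWordFor cs hA J c (word J c))
    (g : BasisIndex cs → ℂ) (hg : ∑ p, g p • nablaPi cs hA word p = 0) : g = 0 := by
  classical
  by_contra hne
  obtain ⟨p', hp'⟩ : ∃ p, g p ≠ 0 := by
    by_contra hc
    push Not at hc
    exact hne (funext hc)
  obtain ⟨q, hq, hqmin⟩ := Finset.exists_min_image (Finset.univ.filter fun p => g p ≠ 0)
    (fun p => cs.length p.1.2) ⟨p', by simpa using hp'⟩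
  simp only [Finset.mem_filter, Finset.mem_univ, true_and] at hq hqmin
  obtain ⟨⟨⟨w, t⟩, hwt⟩, hr, hrmax⟩ := Finset.exists_max_image
    (Finset.univ.filter fun p => g p ≠ 0 ∧ p.1.2 = q.1.2)
    (fun p => (word (leftDescents cs p.1.2) p.1.1).length) ⟨q, by simpa using hq⟩
  simp only [Finset.mem_filter, Finset.mem_univ, true_and] at hr hrmax
  obtain ⟨hr0, hrq⟩ := hr
  rw [← hrq] at hqmin hrmax
  obtain ⟨ν, hν, hone⟩ := (hword (leftDescents cs t) w).exists_parabolicCoeff_eq_one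
  have h := congrArg (matrixCoeff cs ν t) hg
  rw [map_sum, map_zero, Finset.sum_eq_single ⟨(w, t), hwt⟩] at h
  · rw [map_smul, matrixCoeff_nablaPi_self word ⟨(w, t), hwt⟩, hone, smul_eq_mul, mul_one] at h
    exact hr0 h
  · rintro ⟨⟨w', t'⟩, hwt'⟩ - hpne
    rw [map_smul, smul_eq_mul, mul_eq_zero, or_iff_not_imp_left]
    intro hg0
    by_cases ht : t' = t
    · subst ht
      rw [matrixCoeff_nablaPi_self word ⟨(w', t'), hwt'⟩]
      refine (hword _ _).parabolicCoeff_eq_zero (hword _ _) ?_ ?_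
      · rw [hν]
        intro hc
        apply hpne
        -- Both w and w' are minimal in their cosets of W_J, so distinct pairs with the same t have
        -- distinct cosets.
        have := eq_of_mk_eq_of_not_isRightDescent cs hA
          (BasisIndex.not_isRightDescent ⟨(w, t'), hwt⟩)
          (BasisIndex.not_isRightDescent ⟨(w', t'), hwt'⟩) hc
        dsimp only at this
        subst this
        rfl
      · rw [hν]
        exact hrmax ⟨(w', t'), hwt'⟩ ⟨hg0, rfl⟩
    · exact matrixCoeff_nablaPi_of_length_le word ht (hqmin _ hg0) ν
  · intro hc
    exact absurd (Finset.mem_univ _) hc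

/-! ### Comparison of the two bounds -/

/-- The module is not assumed to be a group, as subtraction in `RightEnd W` and in its
subalgebras is found along different paths. -/
theorem exists_basis_of_injective {ι V : Type*} [Fintype ι] [Nonempty ι] [AddCommMonoid V]
    [Module ℂ V] (v : ι → V) (hv : ∀ g : ι → ℂ, ∑ i, g i • v i = 0 → g = 0)
    (f : V →ₗ[ℂ] (ι → ℂ)) (hf : Function.Injective f) :
    ∃ b : Module.Basis ι ℂ V, ∀ i, b i = v i := by
  let : AddCommGroup V := Module.addCommMonoidToAddCommGroup ℂ
  have := Module.Finite.of_injective f hf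
  have hli : LinearIndependent ℂ v :=
    Fintype.linearIndependent_iff.2 fun g hg => congrFun (hv g hg)
  refine ⟨basisOfLinearIndependentOfCardEqFinrank hli (le_antisymm ?_ ?_), fun i => ?_⟩
  · exact hli.fintype_card_le_finrank
  · rw [← Module.finrank_fintype_fun_eq_card ℂ]
    exact LinearMap.finrank_le_finrank_of_injective hf
  · rw [coe_basisOfLinearIndependentOfCardEqFinrank]

end HeckeGroup

end

/-- For every choice of one `S`-reduced word per coset `w W_J`, the family
`∇_{w W_{D_L(t)}} π_t`, indexed by the pairs `(w, t)` with `D_R(w) ∩ D_L(t) = ∅`, is a basis of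
the Hecke group algebra. -/
theorem mainTheorem7 {B W : Type*} [Group W] [Finite W] {M : CoxeterMatrix B}
    (cs : CoxeterSystem M W) {A : Matrix B B ℝ} (hA : HeckeGroup.IsCartanMatrix M A)
    (S : Set (HeckeGroup.Root cs hA)) (hS : HeckeGroup.ActsTransitively cs hA S)
    (word : ∀ J : Set B, (W ⧸ HeckeGroup.parabolic cs J) → List S)
    (hword : ∀ (J : Set B) (c : W ⧸ HeckeGroup.parabolic cs J),
      HeckeGroup.IsReducedWordFor cs hA J c (word J c)) :
    ∃ b : Module.Basis (HeckeGroup.BasisIndex cs) ℂ (HeckeGroup.heckeGroupAlgebra cs),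
      ∀ p : HeckeGroup.BasisIndex cs,
        (b p : HeckeGroup.RightEnd W) =
          HeckeGroup.nablaWord cs hA
              (word (HeckeGroup.leftDescents cs p.1.2)
                (p.1.1 : W ⧸ HeckeGroup.parabolic cs (HeckeGroup.leftDescents cs p.1.2))) *
            HeckeGroup.piElt cs p.1.2 := by
  have := Fintype.ofFinite (HeckeGroup.BasisIndex cs)
  have : Nonempty (HeckeGroup.BasisIndex cs) := ⟨⟨(1, 1), by
    ext i
    simp [HeckeGroup.rightDescents, cs.not_isRightDescent_one]⟩⟩
  obtain ⟨b, hb⟩ := HeckeGroup.exists_basis_of_injective (HeckeGroup.nablaPi cs hA word)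
    (HeckeGroup.eq_zero_of_sum_nablaPi word hword) _
    (HeckeGroup.injective_antisymmetryCoeff_comp_subtype cs hA)
  exact ⟨b, fun p => by rw [hb]; rfl⟩
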